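/- Let $P=(Z,<)$ be a causal set, that is, a poset on a countably infinite set $Z$ in which every element is above only finitely many elements. For $x\in Z$ let $I(x)$ be the set of elements incomparable with $x$. A stem is a finite down-set of $P$; for $A\subseteq Z$, $P_A$ denotes the restriction of $P$ to $A$. An ordered stem is a finite string $a_1\cdots a_m$ of distinct elements such that $\{a_1,\dots,a_m\}$ is a stem and $a_i<a_j$ implies $i<j$. Let $\Omega^P$ be the set of infinite strings $x_1x_2\cdots$ of distinct elements of $Z$ such that $\{x_1,x_2,\dots\}$ is a down-set and $x_i<x_j$ implies $i<j$. For an ordered stem $a_1\cdots a_m$ let $E(a_1\cdots a_m)$ be the set of elements of $\Omega^P$ with initial segment $a_1\cdots a_m$, and let $\mathcal F^P$ be the $\sigma$-field on $\Omega^P$ generated by all these sets. An order-invariant measure on $P$ is a probability measure $\mu$ on $(\Omega^P,\mathcal F^P)$ such that $\mu(E(a_1\cdots a_m))=\mu(E(a_{s(1)}\cdots a_{s(m)}))$ whenever $s$ is a permutation of $\{1,\dots,m\}$ and both $a_1\cdots a_m$ and $a_{s(1)}\cdots a_{s(m)}$ are ordered stems. For a stem $A$ let $\nu^A$ be the uniform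 probability measure on the set of linear extensions of $P_A$, each written as a string listing the elements of $A$, and for an ordered stem $a_1\cdots a_m$ let $\nu^A(E(a_1\cdots a_m))$ be the $\nu^A$-probability that the linear extension has initial segment $a_1\cdots a_m$ (this is $0$ if some $a_i\notin A$). **Theorem.** Suppose that there is a natural number $k$ such that $|I(x)|\le k$ for all $x\in Z$. Then there is exactly one order-invariant measure $\mu$ on $P$. Moreover, there are increasing sequences $Z_1\subseteq Z_2\subseteq\cdots$ of stems of $P$ with $\bigcup_n Z_n=Z$, and for every such sequence and every ordered stem $a_1\cdots a_m$, $$\lim_{n\to\infty}\nu^{Z_n}(E(a_1\cdots a_m))=\mu(E(a_1\cdots a_m));$$ in particular the limit exists and does not depend on the sequence $(Z_n)$. -/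

import Mathlib

open Set Filter Topology MeasureTheory ProbabilityTheory

namespace Causet

/-- A partially ordered set `Z` is a causal set if it is countably infinite and the set
`D(z) = {y | y < z}` is finite for every element `z`. -/
structure IsCausalSet (Z : Type*) [PartialOrder Z] : Prop where
  countable : Countable Z
  infinite : Infinite Z
  finite_below : ∀ z : Z, {y : Z | y < z}.Finite

/-- `I(x)`: the set of elements incomparable with `x`. -/
def incomparable {Z : Type*} [PartialOrder Z] (x : Z) : Set Z :=
  {y | ¬ x ≤ y ∧ ¬ y ≤ x}

/-- A stem is a finite down-set. -/
def IsStem {Z : Type*} [PartialOrder Z] (A : Finset Z) : Prop :=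
  IsLowerSet (A : Set Z)

/-- The string `a₀ ⋯ a_{k-1}` is an ordered stem: its entries are distinct, they form a down-set
`X`, and the string is a linear extension of the order restricted to `X`. -/
structure IsOrderedStem {Z : Type*} [PartialOrder Z] {k : ℕ} (a : Fin k → Z) : Prop where
  injective : Function.Injective a
  isLowerSet_range : IsLowerSet (range a)
  lt_of_lt : ∀ i j, a i < a j → i < j

/-- The infinite string `ω₀ω₁⋯` is a natural extension of the restriction of the order to some
down-set `X`, which is then the set of its entries: the map `i ↦ ωᵢ` is a bijection from `ℕ` to
`X` whose inverse is order-preserving. -/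
structure IsNaturalExtensionOfDownSet {Z : Type*} [PartialOrder Z] (ω : ℕ → Z) : Prop where
  injective : Function.Injective ω
  isLowerSet_range : IsLowerSet (range ω)
  lt_of_lt : ∀ i j, ω i < ω j → i < j

/-- The sample space `Ω^P`: all natural extensions of restrictions of the order to infinite
down-sets. -/
def SampleSpace (Z : Type*) [PartialOrder Z] : Type _ :=
  {ω : ℕ → Z // IsNaturalExtensionOfDownSet ω}

/-- `E(a₀ ⋯ a_{k-1})`: the elements of the sample space with initial segment `a₀ ⋯ a_{k-1}`. -/
def basicEvent {Z : Type*} [PartialOrder Z] {k : ℕ} (a : Fin k → Z) : Set (SampleSpace Z) :=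
  {ω | ∀ i : Fin k, ω.1 i = a i}

/-- The σ-field on the sample space generated by the basic events of ordered stems. -/
instance (Z : Type*) [PartialOrder Z] : MeasurableSpace (SampleSpace Z) :=
  MeasurableSpace.generateFrom
    {S | ∃ (k : ℕ) (a : Fin k → Z), IsOrderedStem a ∧ S = basicEvent a}

/-- An order-invariant measure: a probability measure on the sample space that gives equal
probability to the basic events of any two ordered stems that are rearrangements of each other. -/
structure IsOrderInvariantMeasure {Z : Type*} [PartialOrder Z]
    (μ : Measure (SampleSpace Z)) : Prop where
  isProbabilityMeasure : IsProbabilityMeasure μ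
  measure_perm : ∀ (k : ℕ) (a : Fin k → Z) (s : Equiv.Perm (Fin k)),
    IsOrderedStem a → IsOrderedStem (a ∘ s) → μ (basicEvent a) = μ (basicEvent (a ∘ s))

/-- The linear extensions of the order restricted to the finite set `A`: bijections from
`{0, …, |A| - 1}` to `A` whose inverse is order-preserving. -/
def StemLinearExtension {Z : Type*} [PartialOrder Z] (A : Finset Z) : Type _ :=
  {f : Fin A.card ≃ A // ∀ i j, (f i : Z) < f j → i < j}

/-- Every set of linear extensions of a finite order is an event. -/
instance {Z : Type*} [PartialOrder Z] (A : Finset Z) : MeasurableSpace (StemLinearExtension A) := ⊤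

/-- `ν^A`: the uniform probability measure on the linear extensions of the order restricted
to `A`. -/
noncomputable def uniformMeasure {Z : Type*} [PartialOrder Z] (A : Finset Z) :
    Measure (StemLinearExtension A) :=
  uniformOn univ

/-- The linear extensions of the order restricted to `A` that have initial segment
`a₀ ⋯ a_{k-1}`. -/
def finiteBasicEvent {Z : Type*} [PartialOrder Z] (A : Finset Z) {k : ℕ} (a : Fin k → Z) :
    Set (StemLinearExtension A) :=
  {f | ∃ h : k ≤ A.card, ∀ i : Fin k, (f.1 (Fin.castLE h i) : Z) = a i}

/-- An increasing sequence of stems whose union is the whole causal set. -/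
structure IsExhaustion {Z : Type*} [PartialOrder Z] (A : ℕ → Finset Z) : Prop where
  isStem : ∀ n, IsStem (A n)
  monotone : Monotone A
  exists_mem : ∀ z : Z, ∃ n, z ∈ A n

end Causet

namespace Causet

variable {Z : Type*} [PartialOrder Z]

/-! Fix an ordered stem `a` of length m and let f(B) be the proportion of linear extensions of a
stem B with initial segment `a`. Deleting the last entry of a random linear extension shows that,
once |B| > m, f(B) is the average of f(B \ {x}) over the law of the last entry x
(`isHarmonic_prefixProb`). Iterating, f(B) is the mean of f over where a downward random walk on
stems, started at B, stands when it first reaches a given size n ≥ m.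

These walks couple. A maximal x that is incomparable with at most k elements is deleted with
probability at least 1/(k+1) (`numExt_le_mul_numExt_erase`), and two stems of size n + (k+1)k
contain a common stem C of size n (`exists_common_stem`). Both walks therefore hit C with
probability at least c = (k+1)^(-(k+1)k), so passing from size n to size n + (k+1)k multiplies an
oscillation bound for f by 1 - c (`IsHarmonic.contract`). Hence f(B) tends to a limit L as |B|
grows, uniformly over all stems B, which gives convergence along every exhaustion.

Under an order-invariant measure, the first n entries, given their set B, form a uniformly random
linear extension of B. The probability of E(a) is thus an average of f(B) over stems of size n, and
so equals L. As the basic events form a generating π-system, this gives uniqueness.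

For existence, only finitely many elements can occur in each position, so the sample space is
compact. A limit of the uniform measures on larger and larger stems, continued to infinite strings,
is order-invariant because basic events are clopen. -/

/-- The string `a` is an initial segment of the string `b`, as far as `b` reaches. -/
def IsPrefix {α : Type*} {m n : ℕ} (a : Fin m → α) (b : Fin n → α) : Prop :=
  ∀ (i : Fin m) (h : (i : ℕ) < n), b ⟨i, h⟩ = a i

lemma isPrefix_init {α : Type*} {m n : ℕ} (hmn : m ≤ n) (a : Fin m → α) (b : Fin (n + 1) → α) :
    IsPrefix a (Fin.init b : Fin n → α) ↔ IsPrefix a b :=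
  ⟨fun h i _ => h i (i.2.trans_le hmn), fun h i hi => h i (hi.trans (Nat.lt_succ_self n))⟩

/-! ### Counting linear extensions by their last entry -/

section

open scoped Classical

/-- The maximal elements of a finite set. -/
noncomputable def maximals (B : Finset Z) : Finset Z :=
  B.filter fun x => ∀ y ∈ B, ¬ x < y

lemma mem_maximals {B : Finset Z} {x : Z} :
    x ∈ maximals B ↔ x ∈ B ∧ ∀ y ∈ B, ¬ x < y := by
  simp [maximals]

lemma IsStem.erase {B : Finset Z} (hB : IsStem B) {x : Z} (hx : x ∈ maximals B) :
    IsStem (B.erase x) := by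
  intro u v huv hu
  simp only [Finset.coe_erase, Set.mem_sdiff, Finset.mem_coe, mem_singleton_iff] at hu ⊢
  refine ⟨hB huv hu.1, ?_⟩
  rintro rfl
  exact (mem_maximals.1 hx).2 u hu.1 (lt_of_le_of_ne huv (Ne.symm hu.2))

/-- A maximal element of B \ C is maximal in B, since anything above it in C would pull it into the
down-set C. Thus B can be reduced to a substem C by deleting maximal elements one at a time. -/
lemma exists_mem_maximals_notMem {B C : Finset Z} (hC : IsStem C) (h : ¬ B ⊆ C) :
    ∃ x ∈ maximals B, x ∉ C := by
  have hne : (B \ C).Nonempty := by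
    rwa [Finset.nonempty_iff_ne_empty, Ne, Finset.sdiff_eq_empty_iff_subset]
  obtain ⟨x, hx⟩ := (B \ C).exists_maximal hne
  have hx' := Finset.mem_sdiff.1 hx.prop
  refine ⟨x, mem_maximals.2 ⟨hx'.1, fun y hy hxy => ?_⟩, hx'.2⟩
  by_cases hyC : y ∈ C
  · exact hx'.2 (hC hxy.le hyC)
  · exact hx.not_gt (Finset.mem_sdiff.2 ⟨hy, hyC⟩) hxy

/-- The linear extensions of `B`, as strings of length `n`. -/
noncomputable def linExt (n : ℕ) (B : Finset Z) : Finset (Fin n → Z) :=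
  (Fintype.piFinset fun _ => B).filter fun b => IsOrderedStem b ∧ Finset.univ.image b = B

lemma mem_linExt {n : ℕ} {B : Finset Z} {b : Fin n → Z} :
    b ∈ linExt n B ↔ IsOrderedStem b ∧ Finset.univ.image b = B := by
  simp only [linExt, Finset.mem_filter, Fintype.mem_piFinset, and_iff_right_iff_imp]
  rintro ⟨-, rfl⟩ i
  exact Finset.mem_image_of_mem _ (Finset.mem_univ _)

lemma coe_image_eq_range {α : Type*} {n : ℕ} (b : Fin n → α) :
    ((Finset.univ.image b : Finset α) : Set α) = range b := by simp

lemma IsOrderedStem.isStem {n : ℕ} {b : Fin n → Z} (hb : IsOrderedStem b) :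
    IsStem (Finset.univ.image b) := by
  rw [IsStem, coe_image_eq_range]
  exact hb.isLowerSet_range

lemma IsOrderedStem.card_image {n : ℕ} {b : Fin n → Z} (hb : IsOrderedStem b) :
    (Finset.univ.image b).card = n := by
  rw [Finset.card_image_of_injective _ hb.injective, Finset.card_univ, Fintype.card_fin]

lemma IsOrderedStem.init {n : ℕ} {b : Fin (n + 1) → Z} (hb : IsOrderedStem b) :
    IsOrderedStem (Fin.init b : Fin n → Z) where
  injective := fun _ _ h => Fin.castSucc_injective _ (hb.injective h)
  isLowerSet_range := by
    rintro _ v hv ⟨i, rfl⟩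
    obtain ⟨j, rfl⟩ := hb.isLowerSet_range hv ⟨i.castSucc, rfl⟩
    induction j using Fin.lastCases with
    | cast j => exact ⟨j, rfl⟩
    | last =>
      have hne : b (Fin.last n) ≠ b i.castSucc := fun h =>
        (Fin.castSucc_lt_last i).ne' (hb.injective h)
      exact absurd (hb.lt_of_lt _ _ (lt_of_le_of_ne hv hne)) (Fin.castSucc_lt_last i).not_gt
  lt_of_lt := fun _ _ h => Fin.castSucc_lt_castSucc_iff.1 (hb.lt_of_lt _ _ h)

lemma IsOrderedStem.last_mem_maximals {n : ℕ} {b : Fin (n + 1) → Z} (hb : IsOrderedStem b) :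
    b (Fin.last n) ∈ maximals (Finset.univ.image b) := by
  refine mem_maximals.2 ⟨Finset.mem_image_of_mem _ (Finset.mem_univ _), fun y hy hlt => ?_⟩
  obtain ⟨j, -, rfl⟩ := Finset.mem_image.1 hy
  exact (Fin.le_last j).not_gt (hb.lt_of_lt _ _ hlt)

lemma image_snoc {α : Type*} {n : ℕ} (b : Fin n → α) (x : α) :
    Finset.univ.image (Fin.snoc b x : Fin (n + 1) → α) = insert x (Finset.univ.image b) := by
  apply Finset.coe_injective
  simp [Fin.range_snoc]

lemma IsOrderedStem.snoc {n : ℕ} {b : Fin n → Z} (hb : IsOrderedStem b) {B : Finset Z}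
    (hB : IsStem B) {x : Z} (hx : x ∈ maximals B) (h : Finset.univ.image b = B.erase x) :
    IsOrderedStem (Fin.snoc b x : Fin (n + 1) → Z) where
  injective := by
    have hxb : ∀ i, b i ≠ x := fun i hi => by
      have : b i ∈ B.erase x := h ▸ Finset.mem_image_of_mem _ (Finset.mem_univ _)
      exact (Finset.mem_erase.1 this).1 hi
    intro i j
    induction i using Fin.lastCases <;> induction j using Fin.lastCases
    · simp
    · simpa using fun h => absurd h.symm (hxb _)
    · simpa using fun h => absurd h (hxb _)
    · simpa using fun h => hb.injective h
  isLowerSet_range := by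
    have := image_snoc b x
    rw [h, Finset.insert_erase (mem_maximals.1 hx).1] at this
    rw [← coe_image_eq_range, this]
    exact hB
  lt_of_lt := by
    intro i j
    induction i using Fin.lastCases <;> induction j using Fin.lastCases
    · simp
    · rename_i j
      have : b j ∈ B.erase x := h ▸ Finset.mem_image_of_mem _ (Finset.mem_univ _)
      simpa using fun hlt => absurd hlt ((mem_maximals.1 hx).2 _ (Finset.mem_of_mem_erase this))
    · simp [Fin.castSucc_lt_last]
    · simpa using hb.lt_of_lt _ _

/-- Splitting a string into its last entry and the rest is a bijection, because the last entry of a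
linear extension is maximal and any maximal element may come last. -/
lemma card_filter_linExt_succ (n : ℕ) {B : Finset Z} (hB : IsStem B)
    (p : (Fin n → Z) → Prop) :
    ((linExt (n + 1) B).filter fun b => p (Fin.init b)).card =
      ∑ x ∈ maximals B, ((linExt n (B.erase x)).filter p).card := by
  rw [Finset.card_eq_sum_card_fiberwise (f := fun b => b (Fin.last n)) (t := maximals B)]
  · refine Finset.sum_congr rfl fun x hx => ?_
    refine Finset.card_nbij' (fun b => (Fin.init b : Fin n → Z))
      (fun b => (Fin.snoc b x : Fin (n + 1) → Z)) ?_ ?_ ?_ ?_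
    · intro b hb
      simp only [Finset.coe_filter, Finset.mem_filter, mem_ofPred_eq, mem_linExt] at hb ⊢
      obtain ⟨⟨⟨hb, rfl⟩, hp⟩, rfl⟩ := hb
      refine ⟨⟨hb.init, ?_⟩, hp⟩
      conv_rhs => rw [← Fin.snoc_init_self b]
      rw [image_snoc, Fin.snoc_last, Finset.erase_insert]
      intro hmem
      obtain ⟨i, -, hi⟩ := Finset.mem_image.1 hmem
      exact (Fin.castSucc_lt_last i).ne (hb.injective hi)
    · intro b hb
      simp only [Finset.coe_filter, Finset.mem_filter, mem_ofPred_eq, mem_linExt] at hb ⊢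
      obtain ⟨⟨hb, hr⟩, hp⟩ := hb
      refine ⟨⟨⟨hb.snoc hB hx hr, ?_⟩, by simpa using hp⟩, by simp⟩
      rw [image_snoc, hr, Finset.insert_erase (mem_maximals.1 hx).1]
    · intro b hb
      simp only [Finset.coe_filter, Finset.mem_filter, mem_ofPred_eq, mem_linExt] at hb
      obtain ⟨-, rfl⟩ := hb
      exact Fin.snoc_init_self b
    · intro b _
      simp
  · intro b hb
    obtain ⟨hb', rfl⟩ := mem_linExt.1 (Finset.mem_filter.1 (Finset.mem_coe.1 hb)).1
    exact hb'.last_mem_maximals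

/-- The number of linear extensions of `B` with initial segment `a`. -/
noncomputable def numPrefix {m : ℕ} (a : Fin m → Z) (B : Finset Z) : ℕ :=
  ((linExt B.card B).filter (IsPrefix a)).card

/-- The number of linear extensions of `B`. -/
noncomputable def numExt (B : Finset Z) : ℕ := (linExt B.card B).card

lemma numPrefix_le_numExt {m : ℕ} (a : Fin m → Z) (B : Finset Z) : numPrefix a B ≤ numExt B :=
  Finset.card_filter_le _ _

lemma numPrefix_eq_sum {m : ℕ} (a : Fin m → Z) {B : Finset Z} (hB : IsStem B)
    (hm : m < B.card) :
    numPrefix a B = ∑ x ∈ maximals B, numPrefix a (B.erase x) := by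
  obtain ⟨n, hn⟩ : ∃ n, B.card = n + 1 := ⟨B.card - 1, by omega⟩
  have h := card_filter_linExt_succ n hB (IsPrefix a)
  simp only [isPrefix_init (show m ≤ n by omega) a] at h
  rw [numPrefix, hn, h]
  refine Finset.sum_congr rfl fun x hx => ?_
  rw [numPrefix, Finset.card_erase_of_mem (mem_maximals.1 hx).1, hn, Nat.add_sub_cancel]

lemma numPrefix_elim0 (B : Finset Z) : numPrefix (Fin.elim0 : Fin 0 → Z) B = numExt B := by
  rw [numPrefix, numExt, Finset.filter_true_of_mem]
  exact fun _ _ i => i.elim0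

lemma numExt_eq_sum {B : Finset Z} (hB : IsStem B) (hne : B.Nonempty) :
    numExt B = ∑ x ∈ maximals B, numExt (B.erase x) := by
  simp only [← numPrefix_elim0]
  exact numPrefix_eq_sum _ hB hne.card_pos

lemma numExt_empty : numExt (∅ : Finset Z) = 1 := by
  rw [numExt, Finset.card_eq_one]
  refine ⟨Fin.elim0, Finset.eq_singleton_iff_unique_mem.2 ⟨mem_linExt.2 ⟨⟨?_, ?_, ?_⟩, ?_⟩, ?_⟩⟩
  · exact fun i => i.elim0
  · rintro _ _ _ ⟨i, -⟩
    exact i.elim0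
  · exact fun i => i.elim0
  · rfl
  · exact fun b _ => funext fun i => i.elim0

lemma numExt_pos {B : Finset Z} (hB : IsStem B) : 0 < numExt B := by
  induction hn : B.card generalizing B with
  | zero => rw [Finset.card_eq_zero.1 hn, numExt_empty]; exact one_pos
  | succ n ih =>
    have hne : B.Nonempty := Finset.card_pos.1 (by omega)
    obtain ⟨x, hx, -⟩ := exists_mem_maximals_notMem (B := B) (C := ∅)
      (by simp [IsStem, isLowerSet_empty])
      (by simpa using hne.ne_empty)
    rw [numExt_eq_sum hB hne]
    refine (ih (hB.erase hx) ?_).trans_le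
      (Finset.single_le_sum (f := fun x => numExt (B.erase x)) (fun _ _ => Nat.zero_le _) hx)
    rw [Finset.card_erase_of_mem (mem_maximals.1 hx).1, hn, Nat.add_sub_cancel]

lemma maximals_erase {B : Finset Z} {x y : Z} (hx : x ∈ maximals B) (hxy : x ≠ y) :
    x ∈ maximals (B.erase y) := by
  rw [mem_maximals] at hx ⊢
  exact ⟨Finset.mem_erase.2 ⟨hxy, hx.1⟩, fun z hz => hx.2 z (Finset.mem_of_mem_erase hz)⟩

/-- The last element of a linear extension is `x` with probability at least `1 / (j + 1)`, if `x`
is maximal and incomparable with at most `j` elements. -/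
lemma numExt_le_mul_numExt_erase (j : ℕ) {B : Finset Z} (hB : IsStem B) {x : Z}
    (hx : x ∈ maximals B) (hj : (B.filter fun y => y ∈ incomparable x).card ≤ j) :
    numExt B ≤ (j + 1) * numExt (B.erase x) := by
  induction j generalizing B with
  | zero =>
    rw [numExt_eq_sum hB ⟨x, (mem_maximals.1 hx).1⟩, Finset.sum_eq_single_of_mem x hx]
    · simp
    · intro y hy hyx
      have : y ∈ B.filter fun y => y ∈ incomparable x := by
        rw [mem_maximals] at hx hy
        exact Finset.mem_filter.2 ⟨hy.1, fun h => hx.2 y hy.1 (lt_of_le_of_ne h hyx.symm),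
          fun h => hy.2 x hx.1 (lt_of_le_of_ne h hyx)⟩
      rw [Nat.le_zero, Finset.card_eq_zero] at hj
      simp [hj] at this
  | succ j ih =>
    rw [numExt_eq_sum hB ⟨x, (mem_maximals.1 hx).1⟩, ← Finset.add_sum_erase _ _ hx]
    -- Every other maximal y is incomparable with x, so x has one fewer incomparable element in B \
    -- {y} and induction applies there. Such y are also maximal in B \ {x}, so the resulting counts
    -- sum to at most `numExt (B.erase x)`.
    have hle : ∑ y ∈ (maximals B).erase x, numExt (B.erase y) ≤
        (j + 1) * numExt (B.erase x) := by
      have hterm : ∀ y ∈ (maximals B).erase x,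
          numExt (B.erase y) ≤ (j + 1) * numExt ((B.erase x).erase y) := by
        intro y hy
        obtain ⟨hyx, hy⟩ := Finset.mem_erase.1 hy
        rw [Finset.erase_right_comm]
        refine ih (hB.erase hy) (maximals_erase hx hyx.symm) ?_
        rw [Finset.filter_erase]
        have : y ∈ B.filter fun y => y ∈ incomparable x := by
          rw [mem_maximals] at hx hy
          exact Finset.mem_filter.2 ⟨hy.1, fun h => hx.2 y hy.1 (lt_of_le_of_ne h hyx.symm),
            fun h => hy.2 x hx.1 (lt_of_le_of_ne h hyx)⟩
        rw [Finset.card_erase_of_mem this]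
        omega
      refine (Finset.sum_le_sum hterm).trans ?_
      rw [← Finset.mul_sum]
      refine Nat.mul_le_mul_left _ ?_
      rcases (B.erase x).eq_empty_or_nonempty with h0 | hne
      · have : (maximals B).erase x = ∅ := by
          refine Finset.subset_empty.1 (h0 ▸ Finset.erase_subset_erase _ ?_)
          exact Finset.filter_subset _ _
        simp [this]
      · rw [numExt_eq_sum (hB.erase hx) hne]
        refine Finset.sum_le_sum_of_subset fun y hy => ?_
        obtain ⟨hyx, hy⟩ := Finset.mem_erase.1 hy
        exact maximals_erase hy hyx
    linarith

end


/-! ### Harmonic functions on stems and contraction of their oscillation -/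

section

open scoped Classical

/-- `f B` is, for each stem `B` with more than `N` elements, the expectation of `f (B.erase x)`
where `x` is the last element of a uniformly random linear extension of `B`. -/
def IsHarmonic (N : ℕ) (f : Finset Z → ℝ) : Prop :=
  ∀ B, IsStem B → N < B.card →
    f B * numExt B = ∑ x ∈ maximals B, f (B.erase x) * numExt (B.erase x)

lemma IsHarmonic.neg {N : ℕ} {f : Finset Z → ℝ} (hf : IsHarmonic N f) :
    IsHarmonic N fun B => -f B := by
  intro B hB hN
  simp only [neg_mul, Finset.sum_neg_distrib, hf B hB hN]

lemma IsHarmonic.sub_mul {N : ℕ} {f : Finset Z → ℝ} (hf : IsHarmonic N f) (l : ℝ)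
    {B : Finset Z} (hB : IsStem B) (hN : N < B.card) :
    (f B - l) * numExt B = ∑ x ∈ maximals B, (f (B.erase x) - l) * numExt (B.erase x) := by
  have h : (numExt B : ℝ) = ∑ x ∈ maximals B, (numExt (B.erase x) : ℝ) := by
    exact_mod_cast numExt_eq_sum hB (Finset.card_pos.1 (by omega))
  simp only [_root_.sub_mul, Finset.sum_sub_distrib, ← Finset.mul_sum, ← h, hf B hB hN]

lemma card_erase_of_mem_maximals {B : Finset Z} {x : Z} (hx : x ∈ maximals B) {n : ℕ}
    (h : B.card = n + 1) : (B.erase x).card = n := by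
  rw [Finset.card_erase_of_mem (mem_maximals.1 hx).1, h, Nat.add_sub_cancel]

lemma IsHarmonic.le {N n : ℕ} {f : Finset Z → ℝ} (hf : IsHarmonic N f) (hn : N ≤ n) {l : ℝ}
    (hl : ∀ B, IsStem B → B.card = n → l ≤ f B) {B : Finset Z} (hB : IsStem B)
    (hc : n ≤ B.card) : l ≤ f B := by
  obtain ⟨t, ht⟩ := Nat.exists_eq_add_of_le hc
  induction t generalizing B with
  | zero => exact hl B hB ht
  | succ t ih =>
    have hpos : (0 : ℝ) < numExt B := by exact_mod_cast numExt_pos hB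
    refine sub_nonneg.1 (nonneg_of_mul_nonneg_left ?_ hpos)
    rw [hf.sub_mul l hB (by omega)]
    refine Finset.sum_nonneg fun x hx => mul_nonneg (sub_nonneg.2 ?_) (Nat.cast_nonneg _)
    have := card_erase_of_mem_maximals hx (n := n + t) ht
    exact ih (hB.erase hx) (by omega) this

variable {k : ℕ} (hk : ∀ x : Z, (incomparable x).encard ≤ k)
include hk

lemma card_filter_incomparable_le (x : Z) (B : Finset Z) :
    (B.filter fun y => y ∈ incomparable x).card ≤ k := by
  have : ((B.filter fun y => y ∈ incomparable x : Finset Z) : Set Z) ⊆ incomparable x := by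
    intro y hy
    exact (Finset.mem_filter.1 hy).2
  have h := (encard_le_encard this).trans (hk x)
  rw [encard_coe_eq_coe_finsetCard] at h
  exact_mod_cast h

/-- The downward walk from B reaches C with probability at least (k+1)^(-t): at each of the t steps
some maximal element outside C is available and is deleted with probability at least 1/(k+1). On the
remaining paths f is at least l. -/
lemma IsHarmonic.add_pow_mul_le {N n : ℕ} {f : Finset Z → ℝ} (hf : IsHarmonic N f) (hn : N ≤ n)
    {l : ℝ} (hl : ∀ B, IsStem B → B.card = n → l ≤ f B) {C : Finset Z} (hC : IsStem C)
    (hCn : C.card = n) (t : ℕ) {B : Finset Z} (hB : IsStem B) (hCB : C ⊆ B)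
    (ht : B.card = n + t) : l + ((k + 1 : ℝ)⁻¹) ^ t * (f C - l) ≤ f B := by
  induction t generalizing B with
  | zero =>
    have : C = B := Finset.eq_of_subset_of_card_le hCB (by omega)
    subst this
    simp
  | succ t ih =>
    have hpos : (0 : ℝ) < numExt B := by exact_mod_cast numExt_pos hB
    obtain ⟨x, hx, hxC⟩ := exists_mem_maximals_notMem (B := B) hC
      (fun h => by have := Finset.card_le_card h; omega)
    have hcard : ∀ y ∈ maximals B, (B.erase y).card = n + t := fun y hy =>
      card_erase_of_mem_maximals hy ht
    have h1 := ih (hB.erase hx) (Finset.subset_erase.2 ⟨hCB, hxC⟩) (hcard x hx)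
    -- By the minimum principle all terms of the harmonic sum are nonnegative, so only the one for x
    -- is kept.
    have h2 : (f (B.erase x) - l) * numExt (B.erase x) ≤ (f B - l) * numExt B := by
      rw [hf.sub_mul l hB (by omega)]
      refine Finset.single_le_sum
        (f := fun y => (f (B.erase y) - l) * (numExt (B.erase y) : ℝ)) (fun y hy => ?_) hx
      exact mul_nonneg (sub_nonneg.2 (hf.le hn hl (hB.erase hy) (by rw [hcard y hy]; omega)))
        (Nat.cast_nonneg _)
    have h3 : (numExt B : ℝ) ≤ (k + 1) * numExt (B.erase x) := by
      exact_mod_cast numExt_le_mul_numExt_erase k hB hx (card_filter_incomparable_le hk x B)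
    have h4 : (k + 1 : ℝ)⁻¹ * numExt B ≤ numExt (B.erase x) := by
      rw [inv_mul_le_iff₀ (by positivity)]
      exact h3
    have h5 : 0 ≤ f C - l := sub_nonneg.2 (hl C hC hCn)
    have h6 : ((k + 1 : ℝ)⁻¹) ^ (t + 1) * (f C - l) * numExt B ≤ (f B - l) * numExt B :=
      calc ((k + 1 : ℝ)⁻¹) ^ (t + 1) * (f C - l) * numExt B
          = (((k + 1 : ℝ)⁻¹) ^ t * (f C - l)) * ((k + 1 : ℝ)⁻¹ * numExt B) := by ring
        _ ≤ (((k + 1 : ℝ)⁻¹) ^ t * (f C - l)) * numExt (B.erase x) := by gcongr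
        _ ≤ (f (B.erase x) - l) * numExt (B.erase x) := by gcongr; linarith
        _ ≤ _ := h2
    have := le_of_mul_le_mul_right h6 hpos
    linarith

omit hk in
lemma exists_stem_subset_card {D : Finset Z} (hD : IsStem D) {n : ℕ} (hn : n ≤ D.card) :
    ∃ C ⊆ D, IsStem C ∧ C.card = n := by
  obtain ⟨t, ht⟩ := Nat.exists_eq_add_of_le hn
  induction t generalizing D with
  | zero => exact ⟨D, Finset.Subset.refl _, hD, ht⟩
  | succ t ih =>
    obtain ⟨x, hx, -⟩ := exists_mem_maximals_notMem (B := D) (C := ∅)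
      (by simp [IsStem, isLowerSet_empty])
      (by rw [Finset.subset_empty, ← Finset.card_eq_zero]; omega)
    have hc := card_erase_of_mem_maximals hx (n := n + t) ht
    obtain ⟨C, hCD, hC⟩ := ih (hD.erase hx) (by omega) hc
    exact ⟨C, hCD.trans (Finset.erase_subset _ _), hC⟩

omit hk in
lemma ncard_Iio_lt {x y : Z} (hf : (Iio y).Finite) (h : x < y) :
    (Iio x).ncard < (Iio y).ncard :=
  ncard_lt_ncard ⟨Iio_subset_Iio h.le, fun hs => lt_irrefl x (hs h)⟩ hf

omit hk in
lemma not_le_of_ncard_Iio_eq {x y : Z} (hf : (Iio y).Finite) (hne : x ≠ y)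
    (h : (Iio x).ncard = (Iio y).ncard) : ¬ x ≤ y := fun hle =>
  (ncard_Iio_lt hf (lt_of_le_of_ne hle hne)).ne h

/-- No element of B' lies above x ∈ B \ B', so all but at most k elements of B' lie below x; on the
other hand everything below x lies in B \ {x}. So the number of elements below x takes at most k
values. Elements sharing a value form an antichain, hence number at most k + 1. -/
lemma card_sdiff_le (hfin : ∀ z : Z, (Iio z).Finite) {B B' : Finset Z} (hB : IsStem B)
    (hB' : IsStem B') (hc : B.card ≤ B'.card) : (B \ B').card ≤ (k + 1) * k := by
  refine (Finset.card_le_mul_card_image_of_maps_to (f := fun x => (Iio x).ncard)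
    (t := Finset.Ico (B.card - k) B.card) ?_ (k + 1) ?_).trans ?_
  · intro x hx
    obtain ⟨hxB, hxB'⟩ := Finset.mem_sdiff.1 hx
    rw [Finset.mem_Ico]
    have h1 : B' ⊆ (hfin x).toFinset ∪ B'.filter fun y => y ∈ incomparable x := by
      intro y hy
      have hxy : ¬ x ≤ y := fun h => hxB' (hB' h hy)
      by_cases hyx : y ≤ x
      · exact Finset.mem_union_left _ ((hfin x).mem_toFinset.2
          (lt_of_le_of_ne hyx fun h => hxy h.ge))
      · exact Finset.mem_union_right _ (Finset.mem_filter.2 ⟨hy, hxy, hyx⟩)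
    have h2 := (Finset.card_le_card h1).trans (Finset.card_union_le _ _)
    have h3 := card_filter_incomparable_le hk x B'
    have h4 : (hfin x).toFinset ⊆ B.erase x := by
      intro y hy
      have hy' : y < x := (hfin x).mem_toFinset.1 hy
      exact Finset.mem_erase.2 ⟨hy'.ne, hB hy'.le hxB⟩
    have h5 := Finset.card_le_card h4
    rw [Finset.card_erase_of_mem hxB] at h5
    have h6 : 0 < B.card := Finset.card_pos.2 ⟨x, hxB⟩
    rw [ncard_eq_toFinset_card _ (hfin x)]
    omega
  · intro d _
    rcases ((B \ B').filter fun x => (Iio x).ncard = d).eq_empty_or_nonempty with h0 | ⟨x, hx⟩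
    · rw [h0]; simp
    · have hsub : (B \ B').filter (fun x => (Iio x).ncard = d) ⊆
          insert x ((B \ B').filter fun y => y ∈ incomparable x) := by
        intro y hy
        rw [Finset.mem_filter] at hx hy
        rw [Finset.mem_insert]
        by_cases hyx : y = x
        · exact Or.inl hyx
        · refine Or.inr (Finset.mem_filter.2 ⟨hy.1, ?_, ?_⟩)
          · exact not_le_of_ncard_Iio_eq (hfin y) (Ne.symm hyx) (hx.2.trans hy.2.symm)
          · exact not_le_of_ncard_Iio_eq (hfin x) hyx (hy.2.trans hx.2.symm)
      refine (Finset.card_le_card hsub).trans ((Finset.card_insert_le _ _).trans ?_)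
      exact Nat.succ_le_succ (card_filter_incomparable_le hk x _)
  · rw [Nat.card_Ico]
    exact Nat.mul_le_mul_left _ (by omega)

lemma exists_common_stem (hfin : ∀ z : Z, (Iio z).Finite) {B B' : Finset Z} (hB : IsStem B)
    (hB' : IsStem B') {n : ℕ} (h : B.card = n + (k + 1) * k) (h' : B'.card = n + (k + 1) * k) :
    ∃ C, IsStem C ∧ C.card = n ∧ C ⊆ B ∧ C ⊆ B' := by
  have h1 := card_sdiff_le hk hfin hB hB' (by omega)
  have h2 := Finset.card_inter_add_card_sdiff B B'
  have hst : IsStem (B ∩ B') := by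
    rw [IsStem, Finset.coe_inter]
    exact IsLowerSet.inter hB hB'
  obtain ⟨C, hC, hCs, hCc⟩ := exists_stem_subset_card hst (n := n) (by omega)
  exact ⟨C, hCs, hCc, hC.trans Finset.inter_subset_left, hC.trans Finset.inter_subset_right⟩

lemma IsHarmonic.contract (hfin : ∀ z : Z, (Iio z).Finite) {N n : ℕ} {f : Finset Z → ℝ}
    (hf : IsHarmonic N f) (hn : N ≤ n) {l u : ℝ} (hlu : l ≤ u)
    (h : ∀ B, IsStem B → B.card = n → l ≤ f B ∧ f B ≤ u) :
    ∃ l' u' : ℝ, l' ≤ u' ∧ u' - l' = (1 - ((k + 1 : ℝ)⁻¹) ^ ((k + 1) * k)) * (u - l) ∧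
      ∀ B, IsStem B → B.card = n + (k + 1) * k → l' ≤ f B ∧ f B ≤ u' := by
  set c := ((k + 1 : ℝ)⁻¹) ^ ((k + 1) * k)
  have hc : c ≤ 1 := pow_le_one₀ (by positivity) (inv_le_one_of_one_le₀ (by simp))
  have hd : 0 ≤ (1 - c) * (u - l) := mul_nonneg (by linarith) (by linarith)
  set S := f '' {B | IsStem B ∧ B.card = n + (k + 1) * k}
  -- A common substem C gives f(B) ≥ l + c(f(C) - l) and f(B') ≤ u - c(u - f(C)); the value f(C)
  -- cancels in the difference.
  have hdiff : ∀ B B', IsStem B → B.card = n + (k + 1) * k → IsStem B' →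
      B'.card = n + (k + 1) * k → f B' - (1 - c) * (u - l) ≤ f B := by
    intro B B' hB hBc hB' hBc'
    obtain ⟨C, hC, hCn, hCB, hCB'⟩ := exists_common_stem hk hfin hB hB' hBc hBc'
    have h1 := hf.add_pow_mul_le hk hn (fun B hB hBn => (h B hB hBn).1) hC hCn _ hB hCB hBc
    have h2 := hf.neg.add_pow_mul_le hk hn (l := -u)
      (fun B hB hBn => neg_le_neg (h B hB hBn).2) hC hCn _ hB' hCB' hBc'
    linarith
  -- If no stem has this size, `sInf S` is the default 0 and the bounds hold vacuously.
  refine ⟨sInf S, sInf S + (1 - c) * (u - l), by linarith, by ring, fun B hB hBc => ?_⟩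
  have hne : S.Nonempty := ⟨_, B, ⟨hB, hBc⟩, rfl⟩
  constructor
  · refine csInf_le ⟨f B - (1 - c) * (u - l), ?_⟩ ⟨B, ⟨hB, hBc⟩, rfl⟩
    rintro _ ⟨B', ⟨hB', hBc'⟩, rfl⟩
    exact hdiff B' B hB' hBc' hB hBc
  · rw [← sub_le_iff_le_add]
    refine le_csInf hne ?_
    rintro _ ⟨B', ⟨hB', hBc'⟩, rfl⟩
    exact hdiff B' B hB' hBc' hB hBc

lemma IsHarmonic.exists_oscillation_le (hfin : ∀ z : Z, (Iio z).Finite) {N : ℕ}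
    {f : Finset Z → ℝ} (hf : IsHarmonic N f) {l u : ℝ} (hlu : l ≤ u)
    (h : ∀ B, l ≤ f B ∧ f B ≤ u) {ε : ℝ} (hε : 0 < ε) :
    ∃ n, ∀ B B', IsStem B → IsStem B' → n ≤ B.card → n ≤ B'.card → |f B - f B'| ≤ ε := by
  set q := 1 - ((k + 1 : ℝ)⁻¹) ^ ((k + 1) * k) with hq
  have hq0 : 0 ≤ q := sub_nonneg.2 (pow_le_one₀ (by positivity) (inv_le_one_of_one_le₀ (by simp)))
  have hq1 : q < 1 := sub_lt_self _ (by positivity)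
  have iter : ∀ j : ℕ, ∃ n ≥ N, ∃ l' u' : ℝ, l' ≤ u' ∧ u' - l' = q ^ j * (u - l) ∧
      ∀ B, IsStem B → B.card = n → l' ≤ f B ∧ f B ≤ u' := by
    intro j
    induction j with
    | zero => exact ⟨N, le_rfl, l, u, hlu, by simp, fun B _ _ => h B⟩
    | succ j ih =>
      obtain ⟨n, hn, l', u', hlu', he, hb⟩ := ih
      obtain ⟨l'', u'', hlu'', he', hb'⟩ := hf.contract hk hfin hn hlu' hb
      exact ⟨_, hn.trans (Nat.le_add_right _ _), l'', u'', hlu'', by rw [he', he]; ring, hb'⟩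
  have hlim : Tendsto (fun j : ℕ => q ^ j * (u - l)) atTop (𝓝 (0 * (u - l))) :=
    (tendsto_pow_atTop_nhds_zero_of_lt_one hq0 hq1).mul_const _
  rw [zero_mul] at hlim
  obtain ⟨j, hj⟩ := (hlim.eventually (eventually_lt_nhds hε)).exists
  obtain ⟨n, hn, l', u', -, he, hb⟩ := iter j
  refine ⟨n, fun B B' hB hB' hBn hBn' => ?_⟩
  have hlow : ∀ B, IsStem B → n ≤ B.card → l' ≤ f B := fun B hB hBn =>
    hf.le hn (fun B hB hBn => (hb B hB hBn).1) hB hBn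
  have hup : ∀ B, IsStem B → n ≤ B.card → f B ≤ u' := fun B hB hBn =>
    neg_le_neg_iff.1 (hf.neg.le hn (fun B hB hBn => neg_le_neg (hb B hB hBn).2) hB hBn)
  rw [abs_le]
  constructor <;> linarith [hlow B hB hBn, hlow B' hB' hBn', hup B hB hBn, hup B' hB' hBn']

lemma IsHarmonic.exists_limit (hfin : ∀ z : Z, (Iio z).Finite) {N : ℕ}
    {f : Finset Z → ℝ} (hf : IsHarmonic N f) {l u : ℝ} (hlu : l ≤ u)
    (h : ∀ B, l ≤ f B ∧ f B ≤ u) (hstem : ∀ n, ∃ B : Finset Z, IsStem B ∧ B.card = n) :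
    ∃ L : ℝ, ∀ ε > 0, ∃ n, ∀ B, IsStem B → n ≤ B.card → |f B - L| ≤ ε := by
  choose S hS hSc using hstem
  have hosc := fun ε hε => hf.exists_oscillation_le hk hfin hlu h (ε := ε) hε
  have hcauchy : CauchySeq fun n => f (S n) := by
    rw [Metric.cauchySeq_iff']
    intro ε hε
    obtain ⟨n, hn⟩ := hosc (ε / 2) (half_pos hε)
    refine ⟨n, fun m hm => ?_⟩
    rw [Real.dist_eq]
    exact (hn _ _ (hS m) (hS n) (by rw [hSc]; exact hm) (by rw [hSc])).trans_lt (half_lt_self hε)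
  obtain ⟨L, hL⟩ := cauchySeq_tendsto_of_complete hcauchy
  refine ⟨L, fun ε hε => ?_⟩
  obtain ⟨n, hn⟩ := hosc ε hε
  refine ⟨n, fun B hB hBn => ?_⟩
  refine le_of_tendsto ((tendsto_const_nhds.sub hL).abs) ?_
  filter_upwards [eventually_ge_atTop n] with m hm
  exact hn B (S m) hB (hS m) hBn (by rw [hSc]; exact hm)

/-! ### Prefix probabilities -/

omit hk

/-- The probability that a uniformly random linear extension of `B` has initial segment `a`. -/
noncomputable def prefixProb {m : ℕ} (a : Fin m → Z) (B : Finset Z) : ℝ :=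
  numPrefix a B / numExt B

lemma prefixProb_mul_numExt {m : ℕ} (a : Fin m → Z) {B : Finset Z} (hB : IsStem B) :
    prefixProb a B * numExt B = numPrefix a B :=
  div_mul_cancel₀ _ (by exact_mod_cast (numExt_pos hB).ne')

lemma prefixProb_mem_Icc {m : ℕ} (a : Fin m → Z) (B : Finset Z) :
    0 ≤ prefixProb a B ∧ prefixProb a B ≤ 1 :=
  ⟨by unfold prefixProb; positivity,
    div_le_one_of_le₀ (by exact_mod_cast numPrefix_le_numExt a B) (Nat.cast_nonneg _)⟩

/-- The threshold is m because deleting the last entry of a string of length at most m would discard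
a constraint imposed by `a`. -/
lemma isHarmonic_prefixProb {m : ℕ} (a : Fin m → Z) : IsHarmonic m (prefixProb a) := by
  intro B hB hm
  rw [prefixProb_mul_numExt a hB, numPrefix_eq_sum a hB hm, Nat.cast_sum]
  exact Finset.sum_congr rfl fun x hx => (prefixProb_mul_numExt a (hB.erase hx)).symm

/-- For strings of the same length as `B`, having initial segment `a` means being equal to `a`. -/
lemma numPrefix_of_card_eq {m : ℕ} {a : Fin m → Z} (ha : IsOrderedStem a) {B : Finset Z}
    (hB : B.card = m) : numPrefix a B = if Finset.univ.image a = B then 1 else 0 := by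
  subst hB
  have heq : ∀ b : Fin B.card → Z, IsPrefix a b ↔ b = a := fun b =>
    ⟨fun h => funext fun i => h i i.2, fun h i _ => by rw [h]⟩
  simp only [numPrefix, heq]
  split_ifs with h
  · rw [Finset.card_eq_one]
    refine ⟨a, Finset.eq_singleton_iff_unique_mem.2 ⟨?_, fun b hb => (Finset.mem_filter.1 hb).2⟩⟩
    exact Finset.mem_filter.2 ⟨mem_linExt.2 ⟨ha, h⟩, rfl⟩
  · rw [Finset.card_eq_zero, Finset.filter_eq_empty_iff]
    rintro b hb rfl
    exact h (mem_linExt.1 hb).2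

/-- The number of linear extensions with initial segment `a` depends only on the set of entries
of `a`. -/
lemma numPrefix_congr {m : ℕ} {a b : Fin m → Z} (ha : IsOrderedStem a) (hb : IsOrderedStem b)
    (hab : Finset.univ.image a = Finset.univ.image b) {B : Finset Z} (hB : IsStem B)
    (hm : m ≤ B.card) : numPrefix a B = numPrefix b B := by
  obtain ⟨t, ht⟩ := Nat.exists_eq_add_of_le hm
  induction t generalizing B with
  | zero => rw [numPrefix_of_card_eq ha ht, numPrefix_of_card_eq hb ht, hab]
  | succ t ih =>
    rw [numPrefix_eq_sum a hB (by omega), numPrefix_eq_sum b hB (by omega)]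
    refine Finset.sum_congr rfl fun x hx => ?_
    have := card_erase_of_mem_maximals hx (n := m + t) ht
    exact ih (hB.erase hx) (by omega) this

end


/-! ### Natural extensions and finiteness of the set of ordered stems -/

lemma IsCausalSet.finite_Iio (hZ : IsCausalSet Z) (z : Z) : (Iio z).Finite := hZ.finite_below z

/-- A causal set has a natural extension. -/
lemma IsCausalSet.exists_equiv_nat (hZ : IsCausalSet Z) :
    ∃ w : ℕ ≃ Z, ∀ i j, w i < w j → i < j := by
  classical
  have := hZ.countable
  have := hZ.infinite
  obtain ⟨e, he⟩ := exists_injective_nat Z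
  have hfin : ∀ x : Z, (Iic x).Finite := fun x => by
    rw [← Iio_insert]
    exact (hZ.finite_Iio x).insert x
  -- The binary code of the finite down-set below x is a strictly increasing injection into ℕ;
  -- enumerating its range in increasing order gives the natural extension.
  set key : Z → ℕ := fun x => ∑ i ∈ (hfin x).toFinset.image e, 2 ^ i with hkey
  have hinj : Function.Injective key := by
    intro x y hxy
    have h1 := Finset.image_injective he (Finset.geomSum_injective le_rfl hxy)
    rwa [Finite.toFinset_inj, Iic_inj] at h1
  have hmono : StrictMono key := by
    refine Monotone.strictMono_of_injective (fun x y hxy => ?_) hinj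
    refine Finset.sum_le_sum_of_subset (Finset.image_subset_image ?_)
    exact Finite.toFinset_subset_toFinset.2 (Iic_subset_Iic.2 hxy)
  have : Infinite (range key) := (infinite_range_of_injective hinj).to_subtype
  let o := Nat.Subtype.orderIsoOfNat (range key)
  refine ⟨o.toEquiv.trans (Equiv.ofInjective key hinj).symm, fun i j hij => ?_⟩
  have h := hmono hij
  simp only [Equiv.trans_apply, Equiv.apply_ofInjective_symm] at h
  exact o.lt_iff_lt.1 (Subtype.coe_lt_coe.1 h)

lemma IsNaturalExtensionOfDownSet.isOrderedStem {ω : ℕ → Z}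
    (hω : IsNaturalExtensionOfDownSet ω) (n : ℕ) :
    IsOrderedStem fun i : Fin n => ω i where
  injective := fun _ _ h => Fin.ext (hω.injective h)
  isLowerSet_range := by
    rintro _ v hv ⟨i, rfl⟩
    obtain ⟨j, rfl⟩ := hω.isLowerSet_range hv ⟨i, rfl⟩
    have hji : j ≤ i := by
      rcases hv.eq_or_lt with h | h
      · exact (hω.injective h).le
      · exact (hω.lt_of_lt _ _ h).le
    exact ⟨⟨j, hji.trans_lt i.2⟩, rfl⟩
  lt_of_lt := fun _ _ h => hω.lt_of_lt _ _ h

lemma IsOrderedStem.ncard_Iio_lt {n : ℕ} {b : Fin n → Z} (hb : IsOrderedStem b) (i : Fin n) :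
    (Iio (b i)).ncard < n := by
  have hss : Iio (b i) ⊂ range b :=
    ⟨fun y hy => hb.isLowerSet_range (le_of_lt hy) ⟨i, rfl⟩, fun h => lt_irrefl _ (h ⟨i, rfl⟩)⟩
  refine (ncard_lt_ncard hss (finite_range b)).trans_le ?_
  rw [← image_univ]
  refine (ncard_image_le finite_univ).trans ?_
  rw [ncard_univ, Nat.card_eq_fintype_card, Fintype.card_fin]

section

variable {k : ℕ} (hZ : IsCausalSet Z) (hk : ∀ x : Z, (incomparable x).encard ≤ k)
include hZ hk

/-- Elements with equally many predecessors are pairwise incomparable, so each of the n levels is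
finite. -/
lemma finite_setOf_ncard_Iio_lt (n : ℕ) : {x : Z | (Iio x).ncard < n}.Finite := by
  have : {x : Z | (Iio x).ncard < n} = ⋃ d ∈ Finset.range n, {x : Z | (Iio x).ncard = d} := by
    ext x
    simp
  rw [this]
  refine Finset.finite_toSet _ |>.biUnion fun d _ => ?_
  rcases {x : Z | (Iio x).ncard = d}.eq_empty_or_nonempty with h | ⟨x, hx⟩
  · rw [h]; exact finite_empty
  · have hfin : (incomparable x).Finite :=
      finite_of_encard_le_coe (hk x)
    refine (hfin.insert x).subset fun y hy => ?_
    have hxy : (Iio x).ncard = (Iio y).ncard := Eq.trans hx (Eq.symm hy)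
    by_cases h : y = x
    · exact Or.inl h
    · exact Or.inr ⟨not_le_of_ncard_Iio_eq (hZ.finite_Iio y) (Ne.symm h) hxy,
        not_le_of_ncard_Iio_eq (hZ.finite_Iio x) h hxy.symm⟩

lemma finite_orderedStems (n : ℕ) : {b : Fin n → Z | IsOrderedStem b}.Finite :=
  (Finite.pi' fun _ => finite_setOf_ncard_Iio_lt hZ hk n).subset
    fun _ hb i => hb.ncard_Iio_lt i

end

/-! ### Order-invariant measures as averages over stems of a given size -/

lemma measurableSet_basicEvent {m : ℕ} {a : Fin m → Z} (ha : IsOrderedStem a) :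
    MeasurableSet (basicEvent a) :=
  MeasurableSpace.measurableSet_generateFrom ⟨m, a, ha, rfl⟩

lemma isPiSystem_basicEvent :
    IsPiSystem {S : Set (SampleSpace Z) |
      ∃ (k : ℕ) (a : Fin k → Z), IsOrderedStem a ∧ S = basicEvent a} := by
  have key : ∀ {m n : ℕ} {a : Fin m → Z} {b : Fin n → Z}, m ≤ n →
      (basicEvent a ∩ basicEvent b).Nonempty → basicEvent a ∩ basicEvent b = basicEvent b := by
    intro m n a b hmn ⟨ω, ha, hb⟩
    refine inter_eq_self_of_subset_right fun ω' hb' i => ?_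
    rw [← ha i]
    exact (hb' ⟨i, i.2.trans_le hmn⟩).trans (hb ⟨i, i.2.trans_le hmn⟩).symm
  rintro _ ⟨m, a, ha, rfl⟩ _ ⟨n, b, hb, rfl⟩ hne
  rcases le_total m n with h | h
  · exact ⟨n, b, hb, key h hne⟩
  · rw [inter_comm] at hne ⊢
    exact ⟨m, a, ha, key h hne⟩

open scoped Classical in
lemma IsOrderInvariantMeasure.measure_congr {μ : Measure (SampleSpace Z)}
    (hμ : IsOrderInvariantMeasure μ) {n : ℕ} {a b : Fin n → Z} (ha : IsOrderedStem a)
    (hb : IsOrderedStem b) (h : Finset.univ.image a = Finset.univ.image b) :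
    μ (basicEvent a) = μ (basicEvent b) := by
  have hr : range a = range b := by rw [← coe_image_eq_range, h, coe_image_eq_range]
  let s : Equiv.Perm (Fin n) := (Equiv.ofInjective b hb.injective).trans
    ((Equiv.setCongr hr.symm).trans (Equiv.ofInjective a ha.injective).symm)
  have hs : a ∘ s = b := by
    funext i
    simp [s, Equiv.apply_ofInjective_symm]
  have := hμ.measure_perm n a s ha (hs ▸ hb)
  rwa [hs] at this

section

variable {k : ℕ} (hZ : IsCausalSet Z) (hk : ∀ x : Z, (incomparable x).encard ≤ k)
include hZ hk

open scoped Classical in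
lemma measureReal_basicEvent_eq_sum (μ : Measure (SampleSpace Z)) [IsFiniteMeasure μ] {m n : ℕ}
    (hmn : m ≤ n) (a : Fin m → Z) :
    μ.real (basicEvent a) =
      ∑ b ∈ (finite_orderedStems hZ hk n).toFinset.filter (IsPrefix a), μ.real (basicEvent b) := by
  rw [← measureReal_biUnion_finset]
  · congr 1
    ext ω
    simp only [mem_iUnion, Finset.mem_filter, Finite.mem_toFinset, mem_ofPred_eq, exists_prop]
    constructor
    · exact fun h => ⟨_, ⟨ω.2.isOrderedStem n, fun i _ => h i⟩, fun _ => rfl⟩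
    · rintro ⟨b, ⟨-, hp⟩, hb⟩ i
      exact (hb ⟨i, i.2.trans_le hmn⟩).trans (hp i _)
  · intro b _ b' _ hne
    refine disjoint_left.2 fun ω h h' => hne (funext fun i => ?_)
    rw [← h i, ← h' i]
  · exact fun b hb => measurableSet_basicEvent
      ((Finite.mem_toFinset _).1 (Finset.mem_filter.1 hb).1)

open scoped Classical in
/-- Since, given that the first `n` entries form the stem `B`, they form a uniformly random linear
extension of `B`, linear bounds on the probability of an initial segment that hold for all stems of
size `n` hold for every order-invariant measure. -/
lemma IsOrderInvariantMeasure.nonneg_of_forall_stem {μ : Measure (SampleSpace Z)}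
    (hμ : IsOrderInvariantMeasure μ) {m n : ℕ} (hmn : m ≤ n) (a : Fin m → Z) (α β : ℝ)
    (h : ∀ B : Finset Z, IsStem B → B.card = n → 0 ≤ α * numExt B + β * numPrefix a B) :
    0 ≤ α + β * μ.real (basicEvent a) := by
  have := hμ.isProbabilityMeasure
  set O := (finite_orderedStems hZ hk n).toFinset with hO
  have hmem : ∀ b, b ∈ O ↔ IsOrderedStem b := fun b => Finite.mem_toFinset _
  -- The empty string turns the constant α into α times the total mass of the events of length n.
  have h1 : μ.real (basicEvent (Fin.elim0 : Fin 0 → Z)) = 1 := by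
    have : basicEvent (Fin.elim0 : Fin 0 → Z) = univ := eq_univ_of_forall fun ω i => i.elim0
    rw [this, probReal_univ]
  have h2 := measureReal_basicEvent_eq_sum hZ hk μ (Nat.zero_le n) (Fin.elim0 : Fin 0 → Z)
  rw [h1, Finset.filter_true_of_mem (fun _ _ i => i.elim0), ← hO] at h2
  have h3 : α + β * μ.real (basicEvent a) =
      ∑ b ∈ O, (α + if IsPrefix a b then β else 0) * μ.real (basicEvent b) := by
    rw [measureReal_basicEvent_eq_sum hZ hk μ hmn a, Finset.sum_filter, Finset.mul_sum]
    simp only [add_mul, Finset.sum_add_distrib, ← Finset.mul_sum, ← h2, mul_one, ite_mul,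
      zero_mul, mul_ite, mul_zero, ← hO]
  -- Grouping by the set of entries makes the measure constant on each group, which is the full set
  -- of linear extensions of one stem.
  rw [h3, ← Finset.sum_fiberwise_of_maps_to (g := fun b : Fin n → Z => Finset.univ.image b)
    (t := O.image fun b => Finset.univ.image b) (fun b hb => Finset.mem_image_of_mem _ hb)]
  refine Finset.sum_nonneg fun B hB => ?_
  obtain ⟨b₀, hb₀, rfl⟩ := Finset.mem_image.1 hB
  have hb₀' := (hmem b₀).1 hb₀
  have hfib : O.filter (fun b => Finset.univ.image b = Finset.univ.image b₀) =
      linExt n (Finset.univ.image b₀) := by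
    ext b
    rw [Finset.mem_filter, hmem, mem_linExt]
  have hq : ∀ b ∈ linExt n (Finset.univ.image b₀),
      (α + if IsPrefix a b then β else 0) * μ.real (basicEvent b) =
        (α + if IsPrefix a b then β else 0) * μ.real (basicEvent b₀) := by
    intro b hb
    obtain ⟨hb, him⟩ := mem_linExt.1 hb
    rw [measureReal_def, measureReal_def, hμ.measure_congr hb hb₀' him]
  have hpos := h _ hb₀'.isStem hb₀'.card_image
  rw [numExt, numPrefix, hb₀'.card_image] at hpos
  rw [hfib, Finset.sum_congr rfl hq, ← Finset.sum_mul]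
  refine mul_nonneg ?_ measureReal_nonneg
  rw [Finset.sum_add_distrib, Finset.sum_const, ← Finset.sum_filter, Finset.sum_const,
    nsmul_eq_mul, nsmul_eq_mul]
  linarith

lemma IsOrderInvariantMeasure.abs_sub_le {μ : Measure (SampleSpace Z)}
    (hμ : IsOrderInvariantMeasure μ) {m n : ℕ} (hmn : m ≤ n) (a : Fin m → Z) (L ε : ℝ)
    (h : ∀ B : Finset Z, IsStem B → B.card = n → |prefixProb a B - L| ≤ ε) :
    |μ.real (basicEvent a) - L| ≤ ε := by
  have hb : ∀ B : Finset Z, IsStem B → B.card = n →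
      (L - ε) * numExt B ≤ numPrefix a B ∧ (numPrefix a B : ℝ) ≤ (L + ε) * numExt B := by
    intro B hB hBn
    have h1 := abs_le.1 (h B hB hBn)
    rw [← prefixProb_mul_numExt a hB]
    constructor <;> gcongr <;> linarith
  have h1 := hμ.nonneg_of_forall_stem hZ hk hmn a (-(L - ε)) 1
    (fun B hB hBn => by have := (hb B hB hBn).1; linarith)
  have h2 := hμ.nonneg_of_forall_stem hZ hk hmn a (L + ε) (-1)
    (fun B hB hBn => by have := (hb B hB hBn).2; linarith)
  rw [abs_le]
  constructor <;> linarith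

end

/-! ### Uniform measures on linear extensions, in terms of counts -/

open scoped Classical in
/-- The linear extensions of a stem `A`, read as strings. -/
lemma image_coe_stemLinearExtension {A : Finset Z} (hA : IsStem A) :
    (fun (f : StemLinearExtension A) (i : Fin A.card) => (f.1 i : Z)) '' univ =
      linExt A.card A := by
  ext b
  simp only [image_univ, mem_range, Finset.mem_coe, mem_linExt]
  constructor
  · rintro ⟨f, rfl⟩
    have hr : Finset.univ.image (fun i => (f.1 i : Z)) = A := by
      ext z
      simp only [Finset.mem_image, Finset.mem_univ, true_and]
      exact ⟨by rintro ⟨i, rfl⟩; exact (f.1 i).2, fun hz => ⟨f.1.symm ⟨z, hz⟩, by simp⟩⟩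
    refine ⟨⟨fun i j h => f.1.injective (Subtype.ext h), ?_, fun i j h => f.2 i j h⟩, hr⟩
    rw [← coe_image_eq_range, hr]
    exact hA
  · rintro ⟨hb, hr⟩
    have hmem : ∀ i, b i ∈ A := fun i => hr ▸ Finset.mem_image_of_mem _ (Finset.mem_univ i)
    refine ⟨⟨Equiv.ofBijective (fun i => ⟨b i, hmem i⟩)
      ⟨fun i j h => hb.injective (Subtype.ext_iff.1 h), ?_⟩, fun i j h => hb.lt_of_lt i j h⟩, rfl⟩
    rintro ⟨z, hz⟩
    rw [← hr] at hz
    obtain ⟨i, -, rfl⟩ := Finset.mem_image.1 hz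
    exact ⟨i, rfl⟩

lemma injective_coe_stemLinearExtension (A : Finset Z) : Function.Injective
    (fun (f : StemLinearExtension A) (i : Fin A.card) => (f.1 i : Z)) := fun _ _ h =>
  Subtype.ext (Equiv.ext fun i => Subtype.ext (congrFun h i))

lemma finite_stemLinearExtension {A : Finset Z} (hA : IsStem A) :
    Finite (StemLinearExtension A) := by
  refine finite_univ_iff.1 (Finite.of_finite_image ?_ (injective_coe_stemLinearExtension A).injOn)
  rw [image_coe_stemLinearExtension hA]
  exact Finset.finite_toSet _

lemma encard_univ_stemLinearExtension {A : Finset Z} (hA : IsStem A) :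
    (univ : Set (StemLinearExtension A)).encard = numExt A := by
  rw [← (injective_coe_stemLinearExtension A).encard_image, image_coe_stemLinearExtension hA,
    encard_coe_eq_coe_finsetCard, numExt]

/-- The length bound matters: for longer `a` the event is empty, while `IsPrefix` still compares the
positions that exist. -/
lemma encard_finiteBasicEvent {A : Finset Z} (hA : IsStem A) {m : ℕ} (a : Fin m → Z)
    (hm : m ≤ A.card) : (finiteBasicEvent A a).encard = numPrefix a A := by
  rw [← (injective_coe_stemLinearExtension A).encard_image, numPrefix,
    ← encard_coe_eq_coe_finsetCard, Finset.coe_filter]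
  congr 1
  ext b
  have hb := Set.ext_iff.1 (image_coe_stemLinearExtension hA) b
  rw [Finset.mem_coe] at hb
  rw [mem_ofPred_eq, ← hb]
  constructor
  · rintro ⟨f, ⟨h, hf⟩, rfl⟩
    exact ⟨⟨f, mem_univ _, rfl⟩, fun i _ => hf i⟩
  · rintro ⟨⟨f, -, rfl⟩, hp⟩
    exact ⟨f, ⟨hm, fun i => hp i (i.2.trans_le hm)⟩, rfl⟩

lemma isProbabilityMeasure_uniformMeasure {A : Finset Z} (hA : IsStem A) :
    IsProbabilityMeasure (uniformMeasure A) := by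
  have := finite_stemLinearExtension hA
  refine isProbabilityMeasure_uniformOn finite_univ ?_
  rw [← encard_ne_zero, encard_univ_stemLinearExtension hA]
  exact_mod_cast (numExt_pos hA).ne'

lemma uniformMeasure_real_finiteBasicEvent {A : Finset Z} (hA : IsStem A) {m : ℕ}
    (a : Fin m → Z) (hm : m ≤ A.card) :
    (uniformMeasure A).real (finiteBasicEvent A a) = prefixProb a A := by
  have := finite_stemLinearExtension hA
  have := Fintype.ofFinite (StemLinearExtension A)
  have h1 : (Fintype.card (StemLinearExtension A) : ℕ∞) = numExt A := by
    rw [← encard_univ_stemLinearExtension hA, encard_univ, ENat.card_eq_coe_fintype_card]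
  rw [measureReal_def, uniformMeasure, uniformOn_univ, Measure.count_apply MeasurableSpace.measurableSet_top,
    encard_finiteBasicEvent hA a hm, prefixProb, Nat.cast_inj.1 h1]
  simp


/-! ### Exhaustions and approximating measures on infinite strings -/

open scoped Classical in
lemma isStem_image_range (w : ℕ ≃ Z) (hw : ∀ i j, w i < w j → i < j) (n : ℕ) :
    IsStem ((Finset.range n).image w) := by
  intro x y hyx hx
  obtain ⟨i, hi, rfl⟩ := Finset.mem_image.1 (Finset.mem_coe.1 hx)
  obtain ⟨j, rfl⟩ := w.surjective y
  refine Finset.mem_coe.2 (Finset.mem_image_of_mem _ (Finset.mem_range.2 ?_))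
  rcases hyx.eq_or_lt with h | h
  · rw [w.injective h]
    exact Finset.mem_range.1 hi
  · exact (hw _ _ h).trans (Finset.mem_range.1 hi)

lemma IsCausalSet.exists_isExhaustion (hZ : IsCausalSet Z) :
    ∃ A : ℕ → Finset Z, IsExhaustion A ∧ ∀ n, (A n).card = n := by
  classical
  obtain ⟨w, hw⟩ := hZ.exists_equiv_nat
  refine ⟨fun n => (Finset.range n).image w, ⟨isStem_image_range w hw, fun m n h => ?_,
    fun z => ?_⟩, fun n => by rw [Finset.card_image_of_injective _ w.injective, Finset.card_range]⟩
  · exact Finset.image_subset_image (Finset.range_mono h)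
  · exact ⟨w.symm z + 1, Finset.mem_image.2 ⟨w.symm z, by simp, by simp⟩⟩

lemma IsExhaustion.tendsto_card [Infinite Z] {A : ℕ → Finset Z} (hA : IsExhaustion A) :
    Tendsto (fun n => (A n).card) atTop atTop := by
  refine tendsto_atTop_atTop_of_monotone (fun m n h => Finset.card_le_card (hA.monotone h))
    fun b => ?_
  obtain ⟨s, hs⟩ := Infinite.exists_subset_card_eq Z b
  choose N hN using hA.exists_mem
  refine ⟨s.sup N, hs ▸ Finset.card_le_card fun z hz => ?_⟩
  exact hA.monotone (Finset.le_sup hz) (hN z)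

/-- Linear extensions of an initial stem of a natural extension can be continued by that
natural extension. -/
lemma exists_sampleSpace_extension (w : ℕ ≃ Z) (hw : ∀ i j, w i < w j → i < j) {A : Finset Z}
    (hA : IsStem A) (hmem : ∀ i, w i ∈ A ↔ i < A.card) :
    ∃ T : StemLinearExtension A → SampleSpace Z,
      ∀ f i, ∀ h : i < A.card, (T f).1 i = f.1 ⟨i, h⟩ := by
  refine ⟨fun f => ⟨fun i => if h : i < A.card then f.1 ⟨i, h⟩ else w i, ?_, ?_, ?_⟩,
    fun f i h => dif_pos h⟩
  · intro i j hij
    by_cases hi : i < A.card <;> by_cases hj : j < A.card <;> simp only [hi, hj, dite_true,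
      dite_false] at hij
    · exact Fin.ext_iff.1 (f.1.injective (Subtype.ext hij))
    · exact absurd ((hmem j).1 (hij ▸ (f.1 ⟨i, hi⟩).2)) hj
    · exact absurd ((hmem i).1 (hij ▸ (f.1 ⟨j, hj⟩).2)) hi
    · exact w.injective hij
  · convert! isLowerSet_univ
    refine eq_univ_of_forall fun z => ?_
    by_cases hz : z ∈ A
    · exact ⟨f.1.symm ⟨z, hz⟩, by simp⟩
    · have h : ¬ w.symm z < A.card := fun h => hz (by simpa using (hmem (w.symm z)).2 h)
      exact ⟨w.symm z, by simp [h]⟩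
  · intro i j hij
    by_cases hi : i < A.card <;> by_cases hj : j < A.card <;> simp only [hi, hj, dite_true,
      dite_false] at hij
    · exact f.2 _ _ hij
    · omega
    · exact absurd ((hmem i).1 (hA hij.le (f.1 ⟨j, hj⟩).2)) hi
    · exact hw _ _ hij

/-- The measure permutes the first n entries of a fixed natural extension uniformly among the linear
extensions of the stem they form, and leaves the tail alone. -/
lemma IsCausalSet.exists_measure_eq_prefixProb (hZ : IsCausalSet Z) (n : ℕ) :
    ∃ (ν : ProbabilityMeasure (SampleSpace Z)) (B : Finset Z), IsStem B ∧ B.card = n ∧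
      ∀ (m : ℕ) (a : Fin m → Z), m ≤ n → IsOrderedStem a →
        (ν : Measure (SampleSpace Z)).real (basicEvent a) = prefixProb a B := by
  classical
  obtain ⟨w, hw⟩ := hZ.exists_equiv_nat
  have hB := isStem_image_range w hw n
  have hc : ((Finset.range n).image w).card = n := by
    rw [Finset.card_image_of_injective _ w.injective, Finset.card_range]
  generalize hdef : (Finset.range n).image w = B at hB hc
  have hmem : ∀ i, w i ∈ B ↔ i < B.card := fun i => by
    rw [hc, ← hdef, Finset.mem_image]
    exact ⟨fun ⟨j, hj, h⟩ => w.injective h ▸ Finset.mem_range.1 hj,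
      fun h => ⟨i, Finset.mem_range.2 h, rfl⟩⟩
  obtain ⟨T, hT⟩ := exists_sampleSpace_extension w hw hB hmem
  have hTm : Measurable T := measurable_from_top
  have hp := isProbabilityMeasure_uniformMeasure hB
  refine ⟨⟨(uniformMeasure B).map T, Measure.isProbabilityMeasure_map hTm.aemeasurable⟩, B, hB, hc,
    fun m a hm ha => ?_⟩
  rw [← uniformMeasure_real_finiteBasicEvent hB a (hm.trans_eq hc.symm)]
  simp only [ProbabilityMeasure.coe_mk]
  rw [map_measureReal_apply hTm (measurableSet_basicEvent ha)]
  congr 1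
  ext f
  have hlt : ∀ i : Fin m, (i : ℕ) < B.card := fun i => i.2.trans_le (hm.trans_eq hc.symm)
  constructor
  · exact fun h => ⟨hm.trans_eq hc.symm, fun i => (hT f i (hlt i)).symm.trans (h i)⟩
  · exact fun ⟨_, h⟩ i => (hT f i (hlt i)).trans (h i)

/-! ### Topology and compactness of the sample space -/

section Topology

/-- The topology of pointwise convergence with respect to the discrete topology on `Z`. -/
instance : TopologicalSpace (SampleSpace Z) :=
  letI : TopologicalSpace Z := ⊥
  instTopologicalSpaceSubtype

lemma isClopen_coord (i : ℕ) (S : Set Z) : IsClopen {ω : SampleSpace Z | ω.1 i ∈ S} := by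
  let _ : TopologicalSpace Z := ⊥
  have : DiscreteTopology Z := ⟨rfl⟩
  exact (isClopen_discrete S).preimage ((continuous_apply i).comp continuous_subtype_val)

lemma isClopen_basicEvent {m : ℕ} (a : Fin m → Z) : IsClopen (basicEvent a) := by
  have : basicEvent a = ⋂ i : Fin m, {ω : SampleSpace Z | ω.1 i ∈ ({a i} : Set Z)} := by
    ext ω
    simp [basicEvent]
  rw [this]
  exact isClopen_iInter_of_finite fun i => isClopen_coord _ _

lemma isTopologicalBasis_basicEvent :
    TopologicalSpace.IsTopologicalBasis {S : Set (SampleSpace Z) |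
      ∃ (k : ℕ) (a : Fin k → Z), IsOrderedStem a ∧ S = basicEvent a} := by
  refine TopologicalSpace.isTopologicalBasis_of_isOpen_of_nhds ?_ ?_
  · rintro _ ⟨k, a, -, rfl⟩
    exact (isClopen_basicEvent a).isOpen
  · intro ω U hω hU
    let _ : TopologicalSpace Z := ⊥
    obtain ⟨V, hV, rfl⟩ := isOpen_induced_iff.1 hU
    obtain ⟨I, u, hu, hIu⟩ := isOpen_pi_iff.1 hV ω.1 hω
    refine ⟨_, ⟨I.sup id + 1, _, ω.2.isOrderedStem _, rfl⟩, fun _ => rfl, fun ω' hω' => ?_⟩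
    refine hIu fun i hi => ?_
    have := hω' ⟨i, Nat.lt_succ_of_le (Finset.le_sup (f := id) hi)⟩
    simp only at this
    rw [this]
    exact (hu i hi).2

instance [Countable Z] : SecondCountableTopology (SampleSpace Z) := by
  let _ : TopologicalSpace Z := ⊥
  have : DiscreteTopology Z := ⟨rfl⟩
  exact (IsEmbedding.subtypeVal (p := fun ω : ℕ → Z =>
    IsNaturalExtensionOfDownSet ω)).secondCountableTopology

instance [Countable Z] : BorelSpace (SampleSpace Z) :=
  ⟨isTopologicalBasis_basicEvent.borel_eq_generateFrom.symm⟩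

instance : TopologicalSpace.MetrizableSpace (SampleSpace Z) := by
  let _ : TopologicalSpace Z := ⊥
  have : DiscreteTopology Z := ⟨rfl⟩
  exact (IsEmbedding.subtypeVal (p := fun ω : ℕ → Z =>
    IsNaturalExtensionOfDownSet ω)).metrizableSpace

/-- An element below the entry at position i must occur at a position at most i. With this bound the
existential becomes a finite union, so the down-set condition is visibly closed. -/
lemma setOf_isNaturalExtensionOfDownSet :
    {ω : ℕ → Z | IsNaturalExtensionOfDownSet ω} =
      ({ω | ∀ i j, ω i = ω j → i = j} ∩ {ω | ∀ i j, ω i < ω j → i < j}) ∩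
        {ω | ∀ i, ∀ y ≤ ω i, ∃ j ∈ Finset.range (i + 1), ω j = y} := by
  ext ω
  constructor
  · refine fun h => ⟨⟨fun i j => @h.injective i j, h.lt_of_lt⟩, fun i y hy => ?_⟩
    obtain ⟨j, rfl⟩ := (h.isOrderedStem (i + 1)).isLowerSet_range hy
      ⟨⟨i, Nat.lt_succ_self i⟩, rfl⟩
    exact ⟨j, Finset.mem_range.2 j.2, rfl⟩
  · rintro ⟨⟨h1, h2⟩, h3⟩
    refine ⟨fun i j => h1 i j, ?_, h2⟩
    rintro _ y hy ⟨i, rfl⟩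
    obtain ⟨j, -, hj⟩ := h3 i y hy
    exact ⟨j, hj⟩

/-- The entry at position i has at most i predecessors, so the sample space is a closed subset of a
product of finite sets. -/
lemma compactSpace_sampleSpace {k : ℕ} (hZ : IsCausalSet Z)
    (hk : ∀ x : Z, (incomparable x).encard ≤ k) : CompactSpace (SampleSpace Z) := by
  let _ : TopologicalSpace Z := ⊥
  have : DiscreteTopology Z := ⟨rfl⟩
  refine isCompact_iff_compactSpace.1 (IsCompact.of_isClosed_subset
    (isCompact_univ_pi fun i => (finite_setOf_ncard_Iio_lt hZ hk (i + 1)).isCompact) ?_ ?_)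
  · have hcl : ∀ (i j : ℕ) (S : Set (Z × Z)), IsClosed {ω : ℕ → Z | (ω i, ω j) ∈ S} :=
      fun i j S => (isClosed_discrete S).preimage
        ((continuous_apply i).prodMk (continuous_apply j))
    change IsClosed {ω : ℕ → Z | IsNaturalExtensionOfDownSet ω}
    rw [setOf_isNaturalExtensionOfDownSet]
    refine (IsClosed.inter ?_ ?_).inter ?_
    · simp only [ofPred_forall]
      exact isClosed_iInter fun i => isClosed_iInter fun j => hcl i j {p | p.1 = p.2 → i = j}
    · simp only [ofPred_forall]
      exact isClosed_iInter fun i => isClosed_iInter fun j => hcl i j {p | p.1 < p.2 → i < j}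
    · have : {ω : ℕ → Z | ∀ i, ∀ y ≤ ω i, ∃ j ∈ Finset.range (i + 1), ω j = y} =
          ⋂ (i : ℕ) (y : Z), {ω | y ≤ ω i → ∃ j ∈ Finset.range (i + 1), ω j = y} := by
        ext ω
        simp only [mem_iInter, mem_ofPred_eq]
      rw [this]
      refine isClosed_iInter fun i => isClosed_iInter fun y => ?_
      have : {ω : ℕ → Z | y ≤ ω i → ∃ j ∈ Finset.range (i + 1), ω j = y} =
          {ω | (ω i, ω i) ∈ {p : Z × Z | ¬ y ≤ p.1}} ∪
            ⋃ j ∈ Finset.range (i + 1), {ω | (ω j, ω j) ∈ {p : Z × Z | p.1 = y}} := by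
        ext ω
        simp only [mem_union, mem_iUnion, mem_ofPred_eq, exists_prop, imp_iff_not_or]
      rw [this]
      exact (hcl _ _ _).union ((Finset.finite_toSet _).isClosed_biUnion fun j _ => hcl _ _ _)
  · intro ω hω i _
    exact (IsNaturalExtensionOfDownSet.isOrderedStem hω (i + 1)).ncard_Iio_lt
      ⟨i, Nat.lt_succ_self i⟩

end Topology

/-! ### Existence, uniqueness and convergence -/

section

variable {k : ℕ} (hZ : IsCausalSet Z) (hk : ∀ x : Z, (incomparable x).encard ≤ k)
include hZ hk

lemma exists_isOrderInvariantMeasure :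
    ∃ μ : Measure (SampleSpace Z), IsOrderInvariantMeasure μ := by
  classical
  have := hZ.countable
  have := compactSpace_sampleSpace hZ hk
  choose ν B hB hBc hν using hZ.exists_measure_eq_prefixProb
  -- Compactness of the space of probability measures makes the ultrafilter limit exist, with no
  -- passage to subsequences.
  let μ : ProbabilityMeasure (SampleSpace Z) := ((hyperfilter ℕ).map ν).lim
  have hlim : Tendsto ν (hyperfilter ℕ : Filter ℕ) (𝓝 μ) := Ultrafilter.le_nhds_lim _
  refine ⟨μ, inferInstance, fun m a s ha hs => ?_⟩
  have h1 := ProbabilityMeasure.tendsto_measure_of_isClopen_of_tendsto hlim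
    (isClopen_basicEvent a)
  have h2 := ProbabilityMeasure.tendsto_measure_of_isClopen_of_tendsto hlim
    (isClopen_basicEvent (a ∘ s))
  have him : Finset.univ.image a = Finset.univ.image (a ∘ s) := by
    apply Finset.coe_injective
    rw [coe_image_eq_range, coe_image_eq_range, s.surjective.range_comp]
  have heq : ∀ᶠ n in (hyperfilter ℕ : Filter ℕ),
      ν n (basicEvent a) = ν n (basicEvent (a ∘ s)) := by
    filter_upwards [Nat.hyperfilter_le_atTop (eventually_ge_atTop m)] with n hn
    refine NNReal.coe_injective ?_
    change (ν n : Measure (SampleSpace Z)).real _ = (ν n : Measure (SampleSpace Z)).real _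
    rw [hν n m a hn ha, hν n m _ hn hs, prefixProb, prefixProb,
      numPrefix_congr ha hs him (hB n) (hn.trans_eq (hBc n).symm)]
  have := tendsto_nhds_unique (h1.congr' heq) h2
  rw [← ProbabilityMeasure.ennreal_coeFn_eq_coeFn_toMeasure, this,
    ProbabilityMeasure.ennreal_coeFn_eq_coeFn_toMeasure]

lemma exists_prefixProb_limit {m : ℕ} (a : Fin m → Z) :
    ∃ L : ℝ, (∀ ε > 0, ∃ n, ∀ B : Finset Z, IsStem B → n ≤ B.card → |prefixProb a B - L| ≤ ε) ∧
      ∀ μ : Measure (SampleSpace Z), IsOrderInvariantMeasure μ → μ.real (basicEvent a) = L := by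
  obtain ⟨A, hA, hAc⟩ := hZ.exists_isExhaustion
  obtain ⟨L, hL⟩ := (isHarmonic_prefixProb a).exists_limit hk hZ.finite_Iio zero_le_one
    (prefixProb_mem_Icc a) fun n => ⟨A n, hA.isStem n, hAc n⟩
  refine ⟨L, hL, fun μ hμ => ?_⟩
  refine eq_of_abs_sub_le_all fun ε hε => ?_
  obtain ⟨n, hn⟩ := hL ε hε
  -- The size must be at least m as well, so that strings of that length determine whether `a` is an
  -- initial segment.
  exact hμ.abs_sub_le hZ hk (le_max_right n m) a L ε
    fun B hB hBc => hn B hB (by rw [hBc]; exact le_max_left n m)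

lemma IsOrderInvariantMeasure.eq {μ ν : Measure (SampleSpace Z)}
    (hμ : IsOrderInvariantMeasure μ) (hν : IsOrderInvariantMeasure ν) : μ = ν := by
  have := hμ.isProbabilityMeasure
  have := hν.isProbabilityMeasure
  refine ext_of_generate_finite _ rfl isPiSystem_basicEvent ?_ (by simp)
  rintro _ ⟨m, a, -, rfl⟩
  obtain ⟨L, -, hL⟩ := exists_prefixProb_limit hZ hk a
  rw [← measureReal_eq_measureReal_iff, hL μ hμ, hL ν hν]

lemma IsOrderInvariantMeasure.tendsto_uniformMeasure {μ : Measure (SampleSpace Z)}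
    (hμ : IsOrderInvariantMeasure μ) {A : ℕ → Finset Z} (hA : IsExhaustion A) {m : ℕ}
    (a : Fin m → Z) :
    Tendsto (fun n => uniformMeasure (A n) (finiteBasicEvent (A n) a)) atTop
      (𝓝 (μ (basicEvent a))) := by
  have := hZ.infinite
  have := hμ.isProbabilityMeasure
  obtain ⟨L, hL, hLμ⟩ := exists_prefixProb_limit hZ hk a
  have hcard := hA.tendsto_card
  have hreal : Tendsto (fun n => prefixProb a (A n)) atTop (𝓝 L) := by
    rw [Metric.tendsto_atTop']
    intro ε hε
    obtain ⟨n, hn⟩ := hL (ε / 2) (half_pos hε)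
    obtain ⟨N, hN⟩ := eventually_atTop.1 (hcard.eventually_ge_atTop n)
    exact ⟨N, fun i hi => (hn _ (hA.isStem i) (hN i hi.le)).trans_lt (half_lt_self hε)⟩
  rw [← hLμ μ hμ] at hreal
  have hE := ENNReal.tendsto_ofReal hreal
  rw [ofReal_measureReal] at hE
  refine hE.congr' ?_
  filter_upwards [hcard.eventually_ge_atTop m] with n hn
  have := isProbabilityMeasure_uniformMeasure (hA.isStem n)
  rw [← uniformMeasure_real_finiteBasicEvent (hA.isStem n) a hn, ofReal_measureReal]

end

end Causet

theorem theorem8p1 {Z : Type*} [PartialOrder Z] (hZ : Causet.IsCausalSet Z)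
    (k : ℕ) (hk : ∀ x : Z, (Causet.incomparable x).encard ≤ k) :
    (∃! μ : Measure (Causet.SampleSpace Z), Causet.IsOrderInvariantMeasure μ) ∧
    (∃ A : ℕ → Finset Z, Causet.IsExhaustion A) ∧
    ∀ μ : Measure (Causet.SampleSpace Z), Causet.IsOrderInvariantMeasure μ →
      ∀ A : ℕ → Finset Z, Causet.IsExhaustion A →
        ∀ (m : ℕ) (a : Fin m → Z), Causet.IsOrderedStem a →
          Tendsto (fun n => Causet.uniformMeasure (A n) (Causet.finiteBasicEvent (A n) a))
            atTop (𝓝 (μ (Causet.basicEvent a))) := by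
  obtain ⟨μ, hμ⟩ := Causet.exists_isOrderInvariantMeasure hZ hk
  obtain ⟨A, hA, -⟩ := hZ.exists_isExhaustion
  exact ⟨⟨μ, hμ, fun ν hν => hν.eq hZ hk hμ⟩, ⟨A, hA⟩,
    fun ν hν A hA m a _ => hν.tendsto_uniformMeasure hZ hk hA a⟩
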